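/- Fix $\rho\in(0,1)$ and let $P_{XY}$ be the doubly symmetric binary distribution on $\{0,1\}^2$: $P_{XY}(x,y)=\frac{1+\rho}{4}$ if $x=y$ and $\frac{1-\rho}{4}$ if $x\ne y$. All logarithms are to base $2$ and $D(Q\|P)=\sum_z Q(z)\log\frac{Q(z)}{P(z)}$ denotes relative entropy. For $a,b\in[0,1]$ let $$\mathbb{D}_2(a,b)=\min_{\max(0,a+b-1)\le p\le\min(a,b)} D\!\left(\begin{bmatrix}1+p-a-b & b-p\\ a-p & p\end{bmatrix}\Big\|P_{XY}\right)$$ (rows indexed by the value of $X\in\{0,1\}$ and columns by the value of $Y\in\{0,1\}$), the minimum relative entropy with respect to $P_{XY}$ of a coupling of $\mathrm{Bern}(a)$ and $\mathrm{Bern}(b)$. Let $H_2(t)=-t\log t-(1-t)\log(1-t)$, let $H_2^{-1}:[0,1]\to[0,\frac12]$ be the inverse of the restriction of $H_2$ to $[0,\frac12]$, and put $D_2^{-1}(s)=H_2^{-1}(1-s)$. For $s,t\in[0,1]$ and $\alpha,\beta\in[0,1]$ define $$\psi(s,t)=\mathbb{D}_2\big(D_2^{-1}(s),\,1-D_2^{-1}(t)\big),\qquad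 \widetilde\psi(\alpha,\beta)=\max_{0\le s\le\alpha,\;0\le t\le\beta}\psi(s,t),$$ and let $\overline\Theta$ be the upper concave envelope of $\widetilde\psi$ on $[0,1]^2$, i.e. the pointwise infimum of the concave functions on $[0,1]^2$ that are $\ge\widetilde\psi$ there. Then $\psi$ is concave on $[0,1]^2$. Moreover, the maximum defining $\widetilde\psi$ exists at every point of $[0,1]^2$, and $\widetilde\psi=\psi$ and $\overline\Theta=\psi$ on $[0,1]^2$. -/

import Mathlib

open Set

noncomputable section

namespace DSBS

/-- Relative entropy `D(Q‖P)` in bits on a finite alphabet. It is used only for reference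
distributions `P` with full support; the convention `0 * log (0 / P x) = 0` holds
automatically. -/
def relEntropy {α : Type*} [Fintype α] (Q P : α → ℝ) : ℝ :=
  ∑ x, Q x * Real.logb 2 (Q x / P x)

/-- The doubly symmetric binary distribution with correlation `ρ`. -/
def PXY (ρ : ℝ) : Fin 2 × Fin 2 → ℝ := fun z =>
  if z.1 = z.2 then (1 + ρ) / 4 else (1 - ρ) / 4

/-- The joint distribution on `{0,1} × {0,1}` with `P(X = 1) = a`, `P(Y = 1) = b`,
`P(X = Y = 1) = p` (rows are indexed by the value of `X`, columns by that of `Y`). -/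
def joint (a b p : ℝ) : Fin 2 × Fin 2 → ℝ := fun z =>
  !![1 + p - a - b, b - p; a - p, p] z.1 z.2

/-- The relative entropy of the coupling with parameter `p` of `Bern(a)` and `Bern(b)`. -/
def D2ab (ρ a b p : ℝ) : ℝ := relEntropy (joint a b p) (PXY ρ)

/-- The minimum relative entropy over all couplings of `Bern(a)` and `Bern(b)`,
for `a, b ∈ [0,1]`: a minimum of a continuous function over a nonempty compact interval. -/
def minRelEntropy (ρ a b : ℝ) : ℝ :=
  sInf (D2ab ρ a b '' {p | 0 ≤ p ∧ a + b - 1 ≤ p ∧ p ≤ a ∧ p ≤ b})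

/-- The binary entropy function in bits. -/
def H2 (t : ℝ) : ℝ := Real.binEntropy t / Real.log 2

/-- The inverse of the restriction of `H2` to `[0, 1/2]`. -/
def H2inv : ℝ → ℝ := Function.invFunOn H2 (Icc 0 (1 / 2))

/-- The inverse on `[0, 1]` of `a ↦ 1 - H2 a`, `a ∈ [0, 1/2]`. -/
def D2inv (s : ℝ) : ℝ := H2inv (1 - s)

/-- The function `ψ`. -/
def psi (ρ s t : ℝ) : ℝ := minRelEntropy ρ (D2inv s) (1 - D2inv t)

/-- The values of `ψ` at the points `(s, t)` of the unit square with `s ≤ α`, `t ≤ β`. -/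
def psiValuesBelow (ρ α β : ℝ) : Set ℝ :=
  {y | ∃ s t : ℝ, 0 ≤ s ∧ s ≤ α ∧ 0 ≤ t ∧ t ≤ β ∧ psi ρ s t = y}

/-- The upper increasing envelope `ψ̃` of the minimum-relative-entropy region. -/
def psiTilde (ρ α β : ℝ) : ℝ := sSup (psiValuesBelow ρ α β)

/-- The unit square `[0,1]²`. -/
def unitSquare : Set (ℝ × ℝ) := Icc 0 1 ×ˢ Icc 0 1

/-- The upper concave envelope on `S` of a function `f`: the pointwise infimum of all
concave functions on `S` that are at least `f` on `S`. -/
def upperConcaveEnvelope (S : Set (ℝ × ℝ)) (f : ℝ × ℝ → ℝ) (x : ℝ × ℝ) : ℝ :=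
  sInf {y | ∃ g : ℝ × ℝ → ℝ, ConcaveOn ℝ S g ∧ (∀ z ∈ S, f z ≤ g z) ∧ g x = y}

/-- `Θ̄`, the upper concave envelope of `ψ̃` on the unit square. -/
def ThetaBar (ρ α β : ℝ) : ℝ :=
  upperConcaveEnvelope unitSquare (fun z => psiTilde ρ z.1 z.2) (α, β)

end DSBS

end

open Set

namespace DSBS

/-! It suffices that `psi` is continuous on the square and has, at every interior point, a
supporting plane from above with nonnegative slopes. Concavity and monotonicity then hold inside and
pass to the boundary by continuity; monotonicity makes `psiTilde` equal to `psi`, and concavity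
makes `psi` its own envelope.

After flipping `Y`, the optimal coupling is an exponential tilt of `PXY ρ` by `-x`, `-y`, and
`minRelEntropy_sig` expresses the minimum through x, y and the log-partition function. With slopes
l, m, the entropy bounds `binEntropy_le` at x/l and y/m replace the terms linear in the marginals by
softplus terms. The plane inequality thus reduces to `dualGap` being minimal at the base tilts (x₀,
y₀).

`dualGap` is a difference of convex functions, so stationarity alone is not enough. `dualGap_le`
minimizes over y for fixed x, the minimizer being a multiple of `shift θ x`, and then follows that
curve in x: concavity of `shift` on the positive half-line makes the derivative change sign only at
x₀. -/

/-- The shift of the log-odds of one coordinate caused by an exponential tilt `-y` of the other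
one, for the kernel with crossover weights `1` and agreement weights `θ`. -/
noncomputable def shift (θ y : ℝ) : ℝ := Real.log (Real.exp y + θ) - Real.log (1 + θ * Real.exp y)

/-- The (unnormalized) partition function of the kernel with tilts `-x` and `-y`. -/
noncomputable def partition (θ x y : ℝ) : ℝ :=
  θ + Real.exp (-x) + Real.exp (-y) + θ * (Real.exp (-x) * Real.exp (-y))

/-- The probability of success with log-odds `-z`. -/
noncomputable def sig (z : ℝ) : ℝ := 1 / (1 + Real.exp z)

lemma sig_antitone {u v : ℝ} (h : u ≤ v) : sig v ≤ sig u := by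
  unfold sig
  have := Real.exp_pos u
  gcongr

/-! ### The log-odds shift and solvability for the tilts -/

section Shift

variable {θ : ℝ}

lemma shift_zero : shift θ 0 = 0 := by simp [shift]

lemma hasDerivAt_shift (h0 : 0 < θ) (y : ℝ) :
    HasDerivAt (shift θ)
      (Real.exp y / (Real.exp y + θ) - θ * Real.exp y / (1 + θ * Real.exp y)) y := by
  have hy := Real.exp_pos y
  have h1 : HasDerivAt (fun y => Real.exp y + θ) (Real.exp y) y :=
    (Real.hasDerivAt_exp y).add_const θ
  have h2 : HasDerivAt (fun y => 1 + θ * Real.exp y) (θ * Real.exp y) y :=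
    ((Real.hasDerivAt_exp y).const_mul θ).const_add 1
  exact (h1.log (by positivity)).sub (h2.log (by positivity))

lemma continuous_shift (h0 : 0 < θ) : Continuous (shift θ) :=
  continuous_iff_continuousAt.2 fun y => (hasDerivAt_shift h0 y).continuousAt

lemma shift_neg (h0 : 0 < θ) (y : ℝ) : shift θ (-y) = -shift θ y := by
  have hy := Real.exp_pos y
  have e1 : Real.exp (-y) + θ = (1 + θ * Real.exp y) / Real.exp y := by
    rw [Real.exp_neg]; field_simp
  have e2 : 1 + θ * Real.exp (-y) = (Real.exp y + θ) / Real.exp y := by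
    rw [Real.exp_neg]; field_simp
  rw [shift, shift, e1, e2, Real.log_div (by positivity) (by positivity),
    Real.log_div (by positivity) (by positivity)]
  ring

lemma shift_strictMono (h0 : 0 < θ) (h1 : θ < 1) : StrictMono (shift θ) := by
  refine strictMono_of_hasDerivAt_pos (fun y => hasDerivAt_shift h0 y) fun y => ?_
  have hy := Real.exp_pos y
  rw [div_sub_div _ _ (by positivity) (by positivity)]
  refine div_pos ?_ (by positivity)
  have : Real.exp y * (1 + θ * Real.exp y) - (Real.exp y + θ) * (θ * Real.exp y)
      = Real.exp y * ((1 - θ) * (1 + θ)) := by ring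
  rw [this]
  have : 0 < 1 - θ := by linarith
  positivity

lemma shift_pos (h0 : 0 < θ) (h1 : θ < 1) {y : ℝ} (hy : 0 < y) : 0 < shift θ y := by
  rw [← shift_zero (θ := θ)]
  exact shift_strictMono h0 h1 hy

/-- After exponentiating, the claim is θ(e^{2y} − 1) > 0. -/
lemma shift_lt_self (h0 : 0 < θ) {y : ℝ} (hy : 0 < y) : shift θ y < y := by
  have h := Real.one_lt_exp_iff.2 hy
  have : Real.log (Real.exp y + θ) < Real.log (Real.exp y * (1 + θ * Real.exp y)) :=
    Real.log_lt_log (by positivity)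
      (by nlinarith [mul_pos h0 (sub_pos.2 h), mul_pos h0 (mul_pos (sub_pos.2 h) (sub_pos.2 h))])
  rw [Real.log_mul (by positivity) (by positivity), Real.log_exp] at this
  rw [shift]
  linarith

lemma shift_le_neg_log (h0 : 0 < θ) (h1 : θ < 1) (y : ℝ) : shift θ y ≤ -Real.log θ := by
  have hy := Real.exp_pos y
  have : Real.log (θ * (Real.exp y + θ)) ≤ Real.log (1 + θ * Real.exp y) :=
    Real.log_le_log (by positivity) (by nlinarith)
  rw [Real.log_mul (by positivity) (by positivity)] at this
  rw [shift]
  linarith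

lemma log_le_shift (h0 : 0 < θ) (h1 : θ < 1) (y : ℝ) : Real.log θ ≤ shift θ y := by
  have := shift_le_neg_log h0 h1 (-y)
  rw [shift_neg h0] at this
  linarith

/-- With U = e^u and V = e^v, the difference of derivatives has the sign of (V − U)(UV − 1), which
is why the domain is the half-line. -/
lemma concaveOn_shift (h0 : 0 < θ) (h1 : θ < 1) : ConcaveOn ℝ (Ici 0) (shift θ) := by
  refine AntitoneOn.concaveOn_of_deriv (convex_Ici 0) (continuous_shift h0).continuousOn
    (fun y _ => (hasDerivAt_shift h0 y).differentiableAt.differentiableWithinAt) ?_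
  intro u hu v _ huv
  rw [interior_Ici, mem_Ioi] at hu
  rw [(hasDerivAt_shift h0 u).deriv, (hasDerivAt_shift h0 v).deriv]
  have hU := Real.one_lt_exp_iff.2 hu
  have hUV := Real.exp_le_exp.2 huv
  set U := Real.exp u
  set V := Real.exp v
  have hV : 1 < V := hU.trans_le hUV
  rw [div_sub_div _ _ (by positivity) (by positivity),
    div_sub_div _ _ (by positivity) (by positivity), div_le_div_iff₀ (by positivity) (by positivity)]
  have : (U * (1 + θ * U) - (U + θ) * (θ * U)) * ((V + θ) * (1 + θ * V))
      - (V * (1 + θ * V) - (V + θ) * (θ * V)) * ((U + θ) * (1 + θ * U))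
      = (1 - θ) * (1 + θ) * θ * ((V - U) * (U * V - 1)) := by ring
  have h2 : 0 ≤ (1 - θ) * (1 + θ) * θ * ((V - U) * (U * V - 1)) := by
    have : 0 ≤ 1 - θ := by linarith
    have : 0 ≤ V - U := by linarith
    have : 0 ≤ U * V - 1 := by nlinarith
    positivity
  linarith

/-- A concave function vanishing at 0 has a nonincreasing ratio to the identity. -/
lemma mul_shift_le (h0 : 0 < θ) (h1 : θ < 1) {u v : ℝ} (hu : 0 < u) (huv : u ≤ v) :
    u * shift θ v ≤ v * shift θ u := by
  have hv := hu.trans_le huv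
  have h := (concaveOn_shift h0 h1).2 (mem_Ici.2 le_rfl) (mem_Ici.2 hv.le)
    (show (0 : ℝ) ≤ 1 - u / v by rw [sub_nonneg, div_le_one hv]; exact huv)
    (show (0 : ℝ) ≤ u / v by positivity) (by ring)
  simp only [smul_eq_mul, mul_zero, shift_zero, zero_add] at h
  rw [div_mul_cancel₀ _ hv.ne', div_mul_eq_mul_div, div_le_iff₀ hv] at h
  linarith

/-- Every pair of positive log-odds is attained by positive tilts. -/
lemma exists_tilts (h0 : 0 < θ) (h1 : θ < 1) {σ τ : ℝ} (hσ : 0 < σ) (hτ : 0 < τ) :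
    ∃ x y : ℝ, 0 < x ∧ 0 < y ∧ x - shift θ y = σ ∧ y - shift θ x = τ := by
  have hlog := Real.log_neg h0 h1
  -- Substituting y = τ + `shift θ x` leaves one equation in x. Since |`shift`| ≤ −log θ, the points
  -- σ ± log θ bracket a root.
  have hc : Continuous fun x => x - shift θ (τ + shift θ x) :=
    continuous_id.sub ((continuous_shift h0).comp (continuous_const.add (continuous_shift h0)))
  obtain ⟨x, -, hx⟩ := intermediate_value_Icc
    (show σ + Real.log θ ≤ σ - Real.log θ by linarith) hc.continuousOn
    (show σ ∈ Icc _ _ from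
      ⟨by linarith [log_le_shift h0 h1 (τ + shift θ (σ + Real.log θ))],
       by linarith [shift_le_neg_log h0 h1 (τ + shift θ (σ - Real.log θ))]⟩)
  dsimp only at hx
  obtain ⟨y, hy⟩ : ∃ y, y = τ + shift θ x := ⟨_, rfl⟩
  rw [← hy] at hx
  have neg_of : ∀ {z}, shift θ z < 0 → z < 0 := fun {z} h => by
    rw [← shift_zero (θ := θ)] at h
    exact (shift_strictMono h0 h1).lt_iff_lt.1 h
  have hx0 : 0 < x := by
    -- If x ≤ 0, both tilts are negative; there `shift` moves points towards 0, which gives x < y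
    -- and y < x.
    by_contra! hle
    have hy0 : y < 0 := neg_of (by linarith)
    have hx0 : x < 0 := neg_of (by linarith)
    have e1 := shift_lt_self h0 (neg_pos.2 hx0)
    have e2 := shift_lt_self h0 (neg_pos.2 hy0)
    rw [shift_neg h0] at e1 e2
    linarith
  exact ⟨x, y, hx0, by linarith [shift_pos h0 h1 hx0], hx, by linarith⟩

end Shift

/-! ### Global minimality of the dual objective -/

section Partition

variable {θ : ℝ}

lemma partition_pos (h0 : 0 < θ) (x y : ℝ) : 0 < partition θ x y := by
  unfold partition; positivity

lemma partition_comm (θ x y : ℝ) : partition θ x y = partition θ y x := by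
  unfold partition; ring

lemma sig_sub_shift (h0 : 0 < θ) (x y : ℝ) :
    sig (x - shift θ y) = (Real.exp (-x) + θ * (Real.exp (-x) * Real.exp (-y))) / partition θ x y := by
  have hx := Real.exp_pos x
  have hy := Real.exp_pos y
  have e : Real.exp (x - shift θ y)
      = Real.exp x * (1 + θ * Real.exp y) / (Real.exp y + θ) := by
    rw [shift, Real.exp_sub, Real.exp_sub, Real.exp_log (by positivity),
      Real.exp_log (by positivity)]
    field_simp
  rw [sig, e, partition, Real.exp_neg, Real.exp_neg]
  field_simp
  ring

/-- The dual objective whose global minimum is the supporting plane inequality. -/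
noncomputable def dualGap (θ l m x y : ℝ) : ℝ :=
  Real.log (partition θ x y) - l * Real.log (1 + Real.exp (-(x / l)))
    - m * Real.log (1 + Real.exp (-(y / m)))

lemma hasDerivAt_softplus {l : ℝ} (hl : 0 < l) {X : ℝ → ℝ} {X' t : ℝ} (hX : HasDerivAt X X' t) :
    HasDerivAt (fun t => l * Real.log (1 + Real.exp (-(X t / l)))) (-(sig (X t / l) * X')) t := by
  have h1 := ((hX.div_const l).fun_neg.exp.const_add 1).log (by positivity)
  refine (h1.const_mul l).congr_deriv ?_
  rw [sig, Real.exp_neg]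
  field_simp
  ring

lemma hasDerivAt_dualGap (h0 : 0 < θ) {l m : ℝ} (hl : 0 < l) (hm : 0 < m) {X Y : ℝ → ℝ}
    {X' Y' t : ℝ} (hX : HasDerivAt X X' t) (hY : HasDerivAt Y Y' t) :
    HasDerivAt (fun t => dualGap θ l m (X t) (Y t))
      ((sig (X t / l) - sig (X t - shift θ (Y t))) * X'
        + (sig (Y t / m) - sig (Y t - shift θ (X t))) * Y') t := by
  have hZ := partition_pos h0 (X t) (Y t)
  have hx := hX.fun_neg.exp
  have hy := hY.fun_neg.exp
  have hP := (((hx.const_add θ).fun_add hy).fun_add ((hx.fun_mul hy).const_mul θ)).log hZ.ne'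
  have h := (hP.fun_sub (hasDerivAt_softplus hl hX)).fun_sub (hasDerivAt_softplus hm hY)
  refine h.congr_deriv ?_
  rw [sig_sub_shift h0, sig_sub_shift h0, partition_comm θ (Y t) (X t)]
  change _ / partition θ (X t) (Y t) - _ - _ = _
  field_simp
  ring

lemma le_of_deriv_sign {f f' : ℝ → ℝ} {c : ℝ} (hc : 0 < c)
    (hf : ∀ y, 0 < y → HasDerivAt f (f' y) y) (h1 : ∀ y, 0 < y → y ≤ c → f' y ≤ 0)
    (h2 : ∀ y, c ≤ y → 0 ≤ f' y) {y : ℝ} (hy : 0 < y) : f c ≤ f y := by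
  rcases le_total y c with h | h
  · refine antitoneOn_of_hasDerivWithinAt_nonpos (convex_Icc y c)
      (fun z hz => (hf z (hy.trans_le hz.1)).continuousAt.continuousWithinAt)
      (fun z hz => (hf z ?_).hasDerivWithinAt) (fun z hz => h1 z ?_ ?_)
      (left_mem_Icc.2 h) (right_mem_Icc.2 h) h <;> rw [interior_Icc] at hz
    exacts [hy.trans hz.1, hy.trans hz.1, hz.2.le]
  · refine monotoneOn_of_hasDerivWithinAt_nonneg (convex_Icc c y)
      (fun z hz => (hf z (hc.trans_le hz.1)).continuousAt.continuousWithinAt)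
      (fun z hz => (hf z ?_).hasDerivWithinAt) (fun z hz => h2 z ?_)
      (left_mem_Icc.2 h) (right_mem_Icc.2 h) h <;> rw [interior_Icc] at hz
    exacts [hc.trans hz.1, hz.1.le]

/-- The dual objective is minimal over positive tilts at the tilts that define its weights. -/
lemma dualGap_le (h0 : 0 < θ) (h1 : θ < 1) {x₀ y₀ : ℝ} (hx₀ : 0 < x₀) (hy₀ : 0 < y₀)
    (hσ : 0 < x₀ - shift θ y₀) (hτ : 0 < y₀ - shift θ x₀) {x y : ℝ} (hx : 0 < x) (hy : 0 < y) :
    dualGap θ (x₀ / (x₀ - shift θ y₀)) (y₀ / (y₀ - shift θ x₀)) x₀ y₀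
      ≤ dualGap θ (x₀ / (x₀ - shift θ y₀)) (y₀ / (y₀ - shift θ x₀)) x y := by
  set l := x₀ / (x₀ - shift θ y₀) with hl_def
  set m := y₀ / (y₀ - shift θ x₀) with hm_def
  have hl : 0 < l := by positivity
  have hm : 0 < m := by positivity
  have hGx₀ := shift_pos h0 h1 hx₀
  -- Since z/m = z − z/k, the y-derivative vanishes exactly at y = k · `shift θ x`, a curve through
  -- (x₀, y₀).
  set k := y₀ / shift θ x₀ with hk_def
  have hk : 0 < k := by positivity
  have hkx₀ : k * shift θ x₀ = y₀ := by rw [hk_def]; field_simp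
  have hdivl : ∀ z, z / l = z - z * shift θ y₀ / x₀ := fun z => by
    rw [hl_def]; field_simp
  have hdivm : ∀ z, z / m = z - z / k := fun z => by
    rw [hm_def, hk_def]; field_simp
  -- For fixed `x` the objective is minimal at `k * shift θ x`.
  have step1 : dualGap θ l m x (k * shift θ x) ≤ dualGap θ l m x y := by
    have hGx := shift_pos h0 h1 hx
    refine le_of_deriv_sign (f := fun y => dualGap θ l m x y) (by positivity)
      (fun z _ => hasDerivAt_dualGap h0 hl hm (hasDerivAt_const z x) (hasDerivAt_id z)) ?_ ?_ hy
    · intro z _ hzc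
      have : sig (z / m) ≤ sig (z - shift θ x) := by
        refine sig_antitone ?_
        rw [hdivm]
        have : z / k ≤ shift θ x := by rw [div_le_iff₀ hk]; linarith
        linarith
      simp only [mul_zero, zero_add, mul_one]
      linarith
    · intro z hzc
      have : sig (z - shift θ x) ≤ sig (z / m) := by
        refine sig_antitone ?_
        rw [hdivm]
        have : shift θ x ≤ z / k := by rw [le_div_iff₀ hk]; linarith
        linarith
      simp only [mul_zero, zero_add, mul_one]
      linarith
  -- The composition of two shifts grows slower than linearly.
  have hcomp : ∀ u v : ℝ, 0 < u → u ≤ v →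
      u * shift θ (k * shift θ v) ≤ v * shift θ (k * shift θ u) := by
    intro u v hu huv
    have hv := hu.trans_le huv
    have hGu := shift_pos h0 h1 hu
    have hGuv := (shift_strictMono h0 h1).monotone huv
    have hGv := hGu.trans_le hGuv
    have e1 := mul_shift_le h0 h1 (u := k * shift θ u) (v := k * shift θ v) (by positivity)
      (by gcongr)
    have e2 := mul_shift_le h0 h1 hu huv
    have hP : 0 < shift θ (k * shift θ u) := shift_pos h0 h1 (by positivity)
    have e3 : shift θ u * shift θ (k * shift θ v) ≤ shift θ v * shift θ (k * shift θ u) := by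
      refine le_of_mul_le_mul_left ?_ hk
      linarith
    refine le_of_mul_le_mul_left ?_ hGu
    calc shift θ u * (u * shift θ (k * shift θ v))
        = u * (shift θ u * shift θ (k * shift θ v)) := by ring
      _ ≤ u * (shift θ v * shift θ (k * shift θ u)) := by gcongr
      _ = (u * shift θ v) * shift θ (k * shift θ u) := by ring
      _ ≤ (v * shift θ u) * shift θ (k * shift θ u) := by gcongr
      _ = _ := by ring
  refine le_trans ?_ step1
  -- On the curve the y-partial is zero, so the sign depends only on comparing `shift θ (k * shift θ
  -- z)` / z with its value at x₀.
  have step2 := le_of_deriv_sign (f := fun x => dualGap θ l m x (k * shift θ x)) hx₀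
      (fun z _ => hasDerivAt_dualGap h0 hl hm (hasDerivAt_id z)
        ((hasDerivAt_shift h0 z).const_mul k)) ?_ ?_ hx
  · simpa only [hkx₀] using step2
  all_goals
    intro z hz
    try intro hzc
    simp only [hdivm, mul_div_cancel_left₀ _ hk.ne', sub_self, zero_mul, add_zero, mul_one]
  · have h := hcomp z x₀ hz hzc
    rw [hkx₀] at h
    refine sub_nonpos.2 (sig_antitone ?_)
    rw [hdivl]
    have : z * shift θ y₀ / x₀ ≤ shift θ (k * shift θ z) := by
      rw [div_le_iff₀ hx₀]; linarith
    linarith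
  · have h := hcomp x₀ z hx₀ hz
    rw [hkx₀] at h
    refine sub_nonneg.2 (sig_antitone ?_)
    rw [hdivl]
    have : shift θ (k * shift θ z) ≤ z * shift θ y₀ / x₀ := by
      rw [le_div_iff₀ hx₀]; linarith
    linarith

end Partition

end DSBS


namespace DSBS

open Filter Topology

/-! ### Gibbs inequalities -/

section Gibbs

/-- This is 1 + u ≤ e^u at u = c − log(q/P), with equality when q = P e^c. -/
lemma mul_log_div_ge {q P : ℝ} (hq : 0 ≤ q) (hP : 0 < P) (c : ℝ) :
    q * c + q - P * Real.exp c ≤ q * Real.log (q / P) := by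
  rcases hq.eq_or_lt with rfl | hq
  · have := Real.exp_pos c
    have : 0 ≤ P * Real.exp c := by positivity
    simpa using this
  · have h := Real.add_one_le_exp (c - Real.log (q / P))
    rw [Real.exp_sub, Real.exp_log (by positivity)] at h
    have h2 := mul_le_mul_of_nonneg_left h hq.le
    have : q * (Real.exp c / (q / P)) = P * Real.exp c := by field_simp
    linarith

lemma mul_log_div_eq {q P c : ℝ} (hP : 0 < P) (h : q = P * Real.exp c) :
    q * Real.log (q / P) = q * c := by
  rw [h, mul_div_cancel_left₀ _ hP.ne', Real.log_exp]

/-- Gibbs' inequality against the Bernoulli law `sig u`; `binEntropy_sig` is the equality case. -/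
lemma binEntropy_le {p : ℝ} (hp0 : 0 ≤ p) (hp1 : p ≤ 1) (u : ℝ) :
    Real.binEntropy p ≤ Real.log (1 + Real.exp (-u)) + u * p := by
  have hZ : 0 < 1 + Real.exp (-u) := by positivity
  have h1 := mul_log_div_ge hp0 one_pos (-u - Real.log (1 + Real.exp (-u)))
  have h2 := mul_log_div_ge (sub_nonneg.2 hp1) one_pos (-Real.log (1 + Real.exp (-u)))
  rw [Real.exp_sub, Real.exp_log hZ] at h1
  rw [Real.exp_neg (Real.log _), Real.exp_log hZ] at h2
  have h3 : Real.exp (-u) / (1 + Real.exp (-u)) + (1 + Real.exp (-u))⁻¹ = 1 := by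
    field_simp; ring
  rw [Real.binEntropy, Real.log_inv, Real.log_inv]
  simp only [div_one, one_mul] at h1 h2
  linarith

lemma sig_pos (z : ℝ) : 0 < sig z := by unfold sig; positivity

lemma sig_lt_one (z : ℝ) : sig z < 1 := by
  have := Real.exp_pos z
  rw [sig, div_lt_one (by positivity)]
  linarith

lemma binEntropy_sig (z : ℝ) :
    Real.binEntropy (sig z) = Real.log (1 + Real.exp (-z)) + z * sig z := by
  have hz := Real.exp_pos z
  have e1 : (sig z)⁻¹ = Real.exp z * (1 + Real.exp (-z)) := by
    rw [sig, Real.exp_neg]; field_simp; ring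
  have e2 : (1 - sig z)⁻¹ = 1 + Real.exp (-z) := by
    have : 1 - sig z = Real.exp z / (1 + Real.exp z) := by rw [sig]; field_simp; ring
    rw [this, Real.exp_neg]; field_simp; ring
  rw [Real.binEntropy, e1, e2, Real.log_mul (by positivity) (by positivity), Real.log_exp]
  ring

end Gibbs

/-! ### Duality and continuity for the coupling problem -/

section Coupling

lemma D2ab_mul_log_two (ρ a b p : ℝ) : D2ab ρ a b p * Real.log 2 =
    (1 + p - a - b) * Real.log ((1 + p - a - b) / ((1 + ρ) / 4))
      + (b - p) * Real.log ((b - p) / ((1 - ρ) / 4))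
      + (a - p) * Real.log ((a - p) / ((1 - ρ) / 4)) + p * Real.log (p / ((1 + ρ) / 4)) := by
  have h2 : Real.log 2 ≠ 0 := (Real.log_pos one_lt_two).ne'
  simp only [D2ab, relEntropy, Fintype.sum_prod_type, Fin.sum_univ_two, joint, PXY, Real.logb]
  simp
  field_simp
  ring

variable {ρ : ℝ}

/-- Strong duality for the coupling problem with `X`-marginal and flipped `Y`-marginal given by
exponential tilts. -/
lemma minRelEntropy_sig (h0 : 0 < ρ) (h1 : ρ < 1) {θ : ℝ} (hθ : θ = (1 - ρ) / (1 + ρ))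
    (x y : ℝ) :
    minRelEntropy ρ (sig (x - shift θ y)) (1 - sig (y - shift θ x)) * Real.log 2
      = -(x * sig (x - shift θ y)) - y * sig (y - shift θ x)
        - Real.log ((1 + ρ) / 4) - Real.log (partition θ x y) := by
  have hL : 0 < Real.log 2 := Real.log_pos one_lt_two
  have hθ0 : 0 < θ := by rw [hθ]; exact div_pos (by linarith) (by linarith)
  have hP : 0 < (1 + ρ) / 4 := by linarith
  have hP' : 0 < (1 - ρ) / 4 := by linarith
  have hPP : (1 - ρ) / 4 = θ * ((1 + ρ) / 4) := by
    rw [hθ]; field_simp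
  have hZ := partition_pos hθ0 x y
  have hx := Real.exp_pos (-x)
  have hy := Real.exp_pos (-y)
  have ha := sig_sub_shift hθ0 x y
  have hb := sig_sub_shift hθ0 y x
  rw [partition_comm] at hb
  have hZdef : partition θ x y = θ + Real.exp (-x) + Real.exp (-y)
    + θ * (Real.exp (-x) * Real.exp (-y)) := rfl
  set a := sig (x - shift θ y)
  set b := sig (y - shift θ x)
  set Z := partition θ x y
  set P := (1 + ρ) / 4
  -- K normalizes the tilted law: its cells P e^{c} sum to 1.
  set K := Real.log P + Real.log Z with hK
  have hexpK : Real.exp K = P * Z := by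
    rw [hK, Real.exp_add, Real.exp_log hP, Real.exp_log hZ]
  have w1 : P * Real.exp (-y - K) = Real.exp (-y) / Z := by
    rw [Real.exp_sub, hexpK]; field_simp
  have w2 : (1 - ρ) / 4 * Real.exp (0 - K) = θ / Z := by
    rw [Real.exp_sub, hexpK, hPP, Real.exp_zero]; field_simp
  have w3 : (1 - ρ) / 4 * Real.exp (-x + -y - K) = θ * (Real.exp (-x) * Real.exp (-y)) / Z := by
    rw [Real.exp_sub, hexpK, hPP, Real.exp_add]; field_simp
  have w4 : P * Real.exp (-x - K) = Real.exp (-x) / Z := by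
    rw [Real.exp_sub, hexpK]; field_simp
  have hsum : Real.exp (-y) / Z + θ / Z + θ * (Real.exp (-x) * Real.exp (-y)) / Z
      + Real.exp (-x) / Z = 1 := by
    rw [← add_div, ← add_div, ← add_div, div_eq_one_iff_eq hZ.ne', hZdef]; ring
  rw [add_div] at ha hb
  have hc : θ * (Real.exp (-y) * Real.exp (-x)) = θ * (Real.exp (-x) * Real.exp (-y)) := by ring
  rw [hc] at hb
  have p1 : 0 < Real.exp (-y) / Z := by positivity
  have p2 : 0 < θ / Z := by positivity
  have p3 : 0 < θ * (Real.exp (-x) * Real.exp (-y)) / Z := by positivity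
  have p4 : 0 < Real.exp (-x) / Z := by positivity
  have hleast : IsLeast (D2ab ρ a (1 - b) '' {p | 0 ≤ p ∧ a + (1 - b) - 1 ≤ p ∧ p ≤ a ∧ p ≤ 1 - b})
      ((-(x * a) - y * b - K) / Real.log 2) := by
    constructor
    · refine ⟨Real.exp (-x) / Z, ⟨p4.le, by linarith, by linarith, by linarith⟩, ?_⟩
      rw [eq_div_iff hL.ne', D2ab_mul_log_two,
        mul_log_div_eq hP (c := -y - K) (by rw [w1]; linarith),
        mul_log_div_eq hP' (c := 0 - K) (by rw [w2]; linarith),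
        mul_log_div_eq hP' (c := -x + -y - K) (by rw [w3]; linarith),
        mul_log_div_eq hP (c := -x - K) (by rw [w4])]
      ring
    · rintro _ ⟨p, ⟨q1, q2, q3, q4⟩, rfl⟩
      rw [div_le_iff₀ hL, D2ab_mul_log_two]
      -- The exponents are additive in the two coordinates, so p cancels from the summed lower
      -- bound.
      have k1 := mul_log_div_ge (q := 1 + p - a - (1 - b)) (by linarith) hP (-y - K)
      have k2 := mul_log_div_ge (q := 1 - b - p) (by linarith) hP' (0 - K)
      have k3 := mul_log_div_ge (q := a - p) (by linarith) hP' (-x + -y - K)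
      have k4 := mul_log_div_ge (q := p) q1 hP (-x - K)
      rw [w1] at k1
      rw [w2] at k2
      rw [w3] at k3
      rw [w4] at k4
      rw [show P = (1 + ρ) / 4 from rfl] at k1 k4
      linarith
  rw [minRelEntropy, hleast.csInf_eq, div_mul_cancel₀ _ hL.ne', hK]
  ring

lemma continuous_mul_logb_div (P : ℝ) : Continuous fun q : ℝ => q * Real.logb 2 (q / P) := by
  rcases eq_or_ne P 0 with rfl | hP
  · simpa using continuous_const
  have : (fun q : ℝ => q * Real.logb 2 (q / P))
      = fun q => P / Real.log 2 * ((q / P) * Real.log (q / P)) := by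
    funext q
    rw [Real.logb]
    field_simp
  rw [this]
  exact continuous_const.mul (Real.continuous_mul_log.comp (continuous_id.div_const P))

lemma continuous_D2ab (ρ : ℝ) : Continuous fun v : ℝ × ℝ × ℝ => D2ab ρ v.1 v.2.1 v.2.2 := by
  have hent : ∀ z : Fin 2 × Fin 2, Continuous fun v : ℝ × ℝ × ℝ => joint v.1 v.2.1 v.2.2 z := by
    rintro ⟨i, j⟩
    fin_cases i <;> fin_cases j <;> simp [joint] <;> fun_prop
  unfold D2ab relEntropy
  exact continuous_finsetSum _ fun z _ => (continuous_mul_logb_div _).comp (hent z)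

/-- The minimum over couplings as a minimum over a fixed compact interval. -/
lemma minRelEntropy_flip_eq (ρ : ℝ) {a b : ℝ} (ha0 : 0 ≤ a) (ha : a ≤ 1 / 2) (hb0 : 0 ≤ b)
    (hb : b ≤ 1 / 2) :
    minRelEntropy ρ a (1 - b)
      = sInf ((fun w => D2ab ρ a (1 - b) (a - w * min a b)) '' Icc 0 1) := by
  rw [minRelEntropy]
  congr 1
  ext v
  constructor
  -- The constraint p ≤ 1 − b follows from p ≤ a ≤ 1/2 ≤ 1 − b; the others say 0 ≤ a − p ≤ min a b.
  · rintro ⟨p, ⟨h1, h2, h3, -⟩, rfl⟩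
    have hm : a - p ≤ min a b := le_min (by linarith) (by linarith)
    rcases (le_min ha0 hb0).eq_or_lt with h | h
    · refine ⟨0, by simp, ?_⟩
      have : p = a := by linarith
      simp [this]
    · refine ⟨(a - p) / min a b, ⟨div_nonneg (by linarith) h.le, (div_le_one h).2 hm⟩, ?_⟩
      dsimp only
      rw [div_mul_cancel₀ _ h.ne']
      congr 1
      ring
  · rintro ⟨w, ⟨hw0, hw1⟩, rfl⟩
    have hm := le_min ha0 hb0
    have k1 : w * min a b ≤ min a b := mul_le_of_le_one_left hm hw1
    have k2 : 0 ≤ w * min a b := mul_nonneg hw0 hm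
    have k3 := min_le_left a b
    have k4 := min_le_right a b
    exact ⟨_, ⟨by linarith, by linarith, by linarith, by linarith⟩, rfl⟩

lemma continuousOn_minRelEntropy_flip (ρ : ℝ) :
    ContinuousOn (fun v : ℝ × ℝ => minRelEntropy ρ v.1 (1 - v.2))
      (Icc 0 (1 / 2) ×ˢ Icc 0 (1 / 2)) := by
  have hp : Continuous fun u : (ℝ × ℝ) × ℝ =>
      (u.1.1, 1 - u.1.2, u.1.1 - u.2 * min u.1.1 u.1.2) := by fun_prop
  have hc := (continuous_D2ab ρ).comp hp
  simp only [Function.comp_def] at hc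
  obtain ⟨f, hf⟩ : ∃ f : ℝ × ℝ → ℝ → ℝ,
      f = fun v w => D2ab ρ v.1 (1 - v.2) (v.1 - w * min v.1 v.2) := ⟨_, rfl⟩
  have hfc : Continuous ↿f := by
    change Continuous fun u : (ℝ × ℝ) × ℝ => f u.1 u.2
    rw [hf]
    exact hc
  have hinf := IsCompact.continuous_sInf (isCompact_Icc (a := (0 : ℝ)) (b := 1)) hfc
  rw [hf] at hinf
  refine hinf.continuousOn.congr ?_
  rintro ⟨a, b⟩ ⟨⟨ha0, ha⟩, hb0, hb⟩
  exact minRelEntropy_flip_eq ρ ha0 ha hb0 hb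

end Coupling

/-! ### The inverse binary entropy -/

section EntropyInverse

lemma H2_strictMonoOn : StrictMonoOn H2 (Icc 0 (1 / 2)) := by
  intro u hu v hv huv
  rw [one_div] at hu hv
  exact div_lt_div_of_pos_right (Real.binEntropy_strictMonoOn hu hv huv) (Real.log_pos one_lt_two)

lemma continuous_H2 : Continuous H2 := Real.binEntropy_continuous.div_const _

lemma H2_zero : H2 0 = 0 := by simp [H2]

lemma H2_half : H2 (1 / 2) = 1 := by
  rw [H2, one_div, Real.binEntropy_two_inv, div_self (Real.log_pos one_lt_two).ne']

lemma exists_H2_eq {u : ℝ} (hu : u ∈ Icc (0 : ℝ) 1) : ∃ a ∈ Icc (0 : ℝ) (1 / 2), H2 a = u := by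
  have h := intermediate_value_Icc (show (0 : ℝ) ≤ 1 / 2 by norm_num) continuous_H2.continuousOn
  rw [H2_zero, H2_half] at h
  exact h hu

lemma H2inv_mem {u : ℝ} (hu : u ∈ Icc (0 : ℝ) 1) : H2inv u ∈ Icc (0 : ℝ) (1 / 2) :=
  Function.invFunOn_mem (exists_H2_eq hu)

lemma H2_H2inv {u : ℝ} (hu : u ∈ Icc (0 : ℝ) 1) : H2 (H2inv u) = u :=
  Function.invFunOn_eq (exists_H2_eq hu)

/-- The inverse of a continuous injection on a compact set is continuous: preimages of closed sets
are images of compact sets. -/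
lemma continuousOn_H2inv : ContinuousOn H2inv (Icc 0 1) := by
  rw [continuousOn_iff_isClosed]
  intro t ht
  refine ⟨H2 '' (Icc 0 (1 / 2) ∩ t),
    ((isCompact_Icc.inter_right ht).image continuous_H2).isClosed, ?_⟩
  ext u
  constructor
  · rintro ⟨hut, hu⟩
    exact ⟨⟨_, ⟨H2inv_mem hu, hut⟩, H2_H2inv hu⟩, hu⟩
  · rintro ⟨⟨a, ⟨ha, hat⟩, rfl⟩, hu⟩
    refine ⟨?_, hu⟩
    have : H2inv (H2 a) = a := H2_strictMonoOn.injOn (H2inv_mem hu) ha (H2_H2inv hu)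
    rwa [mem_preimage, this]

lemma one_sub_mem_Icc {s : ℝ} (hs : s ∈ Icc (0 : ℝ) 1) : 1 - s ∈ Icc (0 : ℝ) 1 :=
  ⟨by linarith [hs.2], by linarith [hs.1]⟩

lemma continuousOn_D2inv : ContinuousOn D2inv (Icc 0 1) :=
  continuousOn_H2inv.comp (continuous_const.sub continuous_id).continuousOn
    fun _ hs => one_sub_mem_Icc hs

lemma D2inv_mem {s : ℝ} (hs : s ∈ Icc (0 : ℝ) 1) : D2inv s ∈ Icc (0 : ℝ) (1 / 2) :=
  H2inv_mem (one_sub_mem_Icc hs)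

/-- In the interior, `D2inv` has positive log-odds. -/
lemma exists_sig_eq_D2inv {s : ℝ} (hs : s ∈ Ioo (0 : ℝ) 1) :
    ∃ σ, 0 < σ ∧ D2inv s = sig σ ∧ Real.binEntropy (sig σ) = (1 - s) * Real.log 2 := by
  have hs' := one_sub_mem_Icc (Ioo_subset_Icc_self hs)
  have hL : 0 < Real.log 2 := Real.log_pos one_lt_two
  have hmem : D2inv s ∈ Icc (0 : ℝ) (1 / 2) := D2inv_mem (Ioo_subset_Icc_self hs)
  have hH : H2 (D2inv s) = 1 - s := H2_H2inv hs'
  have h0 : D2inv s ≠ 0 := fun h => by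
    rw [h, H2_zero] at hH; linarith [hs.2]
  have h1 : D2inv s ≠ 1 / 2 := fun h => by
    rw [h, H2_half] at hH; linarith [hs.1]
  have ha0 : 0 < D2inv s := lt_of_le_of_ne hmem.1 h0.symm
  have ha1 : D2inv s < 1 / 2 := lt_of_le_of_ne hmem.2 h1
  have hsig : D2inv s = sig (Real.log ((1 - D2inv s) / D2inv s)) := by
    rw [sig, Real.exp_log (div_pos (by linarith) ha0)]
    field_simp
    ring
  refine ⟨_, Real.log_pos ((one_lt_div ha0).2 (by linarith)), hsig, ?_⟩
  rw [← hsig, ← hH, H2, div_mul_cancel₀ _ hL.ne']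

end EntropyInverse

/-! ### Supporting planes, concavity and the envelope -/

section Envelope

lemma continuousOn_psi (ρ : ℝ) :
    ContinuousOn (fun z : ℝ × ℝ => psi ρ z.1 z.2) unitSquare := by
  refine (continuousOn_minRelEntropy_flip ρ).comp
    (f := fun z : ℝ × ℝ => (D2inv z.1, D2inv z.2)) ?_ ?_
  · exact (continuousOn_D2inv.comp continuousOn_fst fun z hz => hz.1).prodMk
      (continuousOn_D2inv.comp continuousOn_snd fun z hz => hz.2)
  · exact fun z hz => ⟨D2inv_mem hz.1, D2inv_mem hz.2⟩

/-- `ψ` has a supporting plane with nonnegative slopes at every interior point. -/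
lemma exists_supporting_plane {ρ : ℝ} (h0 : 0 < ρ) (h1 : ρ < 1) {s₀ t₀ : ℝ}
    (hs₀ : s₀ ∈ Ioo (0 : ℝ) 1) (ht₀ : t₀ ∈ Ioo (0 : ℝ) 1) :
    ∃ l m : ℝ, 0 ≤ l ∧ 0 ≤ m ∧ ∀ s ∈ Ioo (0 : ℝ) 1, ∀ t ∈ Ioo (0 : ℝ) 1,
      psi ρ s t ≤ psi ρ s₀ t₀ + l * (s - s₀) + m * (t - t₀) := by
  have hL : 0 < Real.log 2 := Real.log_pos one_lt_two
  obtain ⟨θ, hθ⟩ : ∃ θ, θ = (1 - ρ) / (1 + ρ) := ⟨_, rfl⟩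
  have hθ0 : 0 < θ := by rw [hθ]; exact div_pos (by linarith) (by linarith)
  have hθ1 : θ < 1 := by rw [hθ, div_lt_one (by linarith)]; linarith
  obtain ⟨σ₀, hσ₀, hDs₀, hHs₀⟩ := exists_sig_eq_D2inv hs₀
  obtain ⟨τ₀, hτ₀, hDt₀, hHt₀⟩ := exists_sig_eq_D2inv ht₀
  obtain ⟨x₀, y₀, hx₀, hy₀, hσx₀, hτy₀⟩ := exists_tilts hθ0 hθ1 hσ₀ hτ₀
  have key₀ := minRelEntropy_sig h0 h1 hθ x₀ y₀
  rw [hσx₀, hτy₀, ← hDs₀, ← hDt₀] at key₀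
  change psi ρ s₀ t₀ * Real.log 2 = _ at key₀
  rw [hDs₀, hDt₀] at key₀
  rw [binEntropy_sig] at hHs₀ hHt₀
  -- These slopes give x₀/l = σ₀ and y₀/m = τ₀, so the entropy bounds are equalities at the base
  -- point.
  refine ⟨x₀ / σ₀, y₀ / τ₀, by positivity, by positivity, fun s hs t ht => ?_⟩
  obtain ⟨σ, hσ, hDs, hHs⟩ := exists_sig_eq_D2inv hs
  obtain ⟨τ, hτ, hDt, hHt⟩ := exists_sig_eq_D2inv ht
  obtain ⟨x, y, hx, hy, hσx, hτy⟩ := exists_tilts hθ0 hθ1 hσ hτ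
  have key := minRelEntropy_sig h0 h1 hθ x y
  rw [hσx, hτy, ← hDs, ← hDt] at key
  change psi ρ s t * Real.log 2 = _ at key
  rw [hDs, hDt] at key
  have hgap := dualGap_le hθ0 hθ1 hx₀ hy₀ (by rw [hσx₀]; exact hσ₀) (by rw [hτy₀]; exact hτ₀) hx hy
  rw [hσx₀, hτy₀] at hgap
  have hl : 0 < x₀ / σ₀ := by positivity
  have hm : 0 < y₀ / τ₀ := by positivity
  have ex₀ : x₀ / (x₀ / σ₀) = σ₀ := by field_simp
  have ey₀ : y₀ / (y₀ / τ₀) = τ₀ := by field_simp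
  have b1 := mul_le_mul_of_nonneg_left
    (binEntropy_le (sig_pos σ).le (sig_lt_one σ).le (x / (x₀ / σ₀))) hl.le
  have b2 := mul_le_mul_of_nonneg_left
    (binEntropy_le (sig_pos τ).le (sig_lt_one τ).le (y / (y₀ / τ₀))) hm.le
  rw [dualGap, dualGap, ex₀, ey₀] at hgap
  have c1 : x₀ * sig σ₀ = (x₀ / σ₀) * (σ₀ * sig σ₀) := by field_simp
  have c2 : y₀ * sig τ₀ = (y₀ / τ₀) * (τ₀ * sig τ₀) := by field_simp
  have c3 : (x₀ / σ₀) * (x / (x₀ / σ₀) * sig σ) = x * sig σ := by field_simp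
  have c4 : (y₀ / τ₀) * (y / (y₀ / τ₀) * sig τ) = y * sig τ := by field_simp
  rw [c1, c2] at key₀
  rw [hHs, mul_add, c3] at b1
  rw [hHt, mul_add, c4] at b2
  have d1 := congrArg (fun r => x₀ / σ₀ * r) hHs₀
  have d2 := congrArg (fun r => y₀ / τ₀ * r) hHt₀
  simp only [mul_add] at d1 d2
  refine le_of_mul_le_mul_right ?_ hL
  set l := x₀ / σ₀
  set m := y₀ / τ₀
  have e : (psi ρ s₀ t₀ + l * (s - s₀) + m * (t - t₀)) * Real.log 2
      = psi ρ s₀ t₀ * Real.log 2 + l * ((1 - s₀) * Real.log 2) - l * ((1 - s) * Real.log 2)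
        + m * ((1 - t₀) * Real.log 2) - m * ((1 - t) * Real.log 2) := by ring
  rw [e]
  linarith

/-- The homothety of the unit square with ratio `1 - ε` about its centre. -/
noncomputable def shrink (ε : ℝ) (z : ℝ × ℝ) : ℝ × ℝ :=
  ((1 - ε) * z.1 + ε * (1 / 2), (1 - ε) * z.2 + ε * (1 / 2))

lemma shrink_coord_mem {ε : ℝ} (hε : ε ∈ Ioo (0 : ℝ) 1) {u : ℝ} (hu : u ∈ Icc (0 : ℝ) 1) :
    (1 - ε) * u + ε * (1 / 2) ∈ Ioo (0 : ℝ) 1 := by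
  have h1 : 0 ≤ (1 - ε) * u := mul_nonneg (by linarith [hε.2]) hu.1
  have h2 : 0 ≤ (1 - ε) * (1 - u) := mul_nonneg (by linarith [hε.2]) (by linarith [hu.2])
  have := hε.1
  constructor <;> nlinarith

lemma shrink_mem {ε : ℝ} (hε : ε ∈ Ioo (0 : ℝ) 1) {z : ℝ × ℝ} (hz : z ∈ unitSquare) :
    shrink ε z ∈ Ioo (0 : ℝ) 1 ×ˢ Ioo (0 : ℝ) 1 :=
  ⟨shrink_coord_mem hε hz.1, shrink_coord_mem hε hz.2⟩

/-- Supporting planes are available only in the open square; this limit carries their consequences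
to the boundary. -/
lemma tendsto_psi_shrink (ρ : ℝ) {z : ℝ × ℝ} (hz : z ∈ unitSquare) :
    Tendsto (fun ε => psi ρ (shrink ε z).1 (shrink ε z).2) (𝓝[>] 0) (𝓝 (psi ρ z.1 z.2)) := by
  refine (continuousOn_psi ρ z hz).tendsto.comp (tendsto_nhdsWithin_iff.2 ⟨?_, ?_⟩)
  · have hc : Continuous fun ε => shrink ε z := by unfold shrink; fun_prop
    have := hc.tendsto 0
    simp only [shrink, sub_zero, one_mul, zero_mul, add_zero] at this
    exact this.mono_left nhdsWithin_le_nhds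
  · filter_upwards [Ioo_mem_nhdsGT (zero_lt_one' ℝ)] with ε hε
    have := shrink_mem hε hz
    exact ⟨Ioo_subset_Icc_self this.1, Ioo_subset_Icc_self this.2⟩

lemma convex_unitSquare : Convex ℝ unitSquare := (convex_Icc 0 1).prod (convex_Icc 0 1)

lemma concaveOn_psi {ρ : ℝ} (h0 : 0 < ρ) (h1 : ρ < 1) :
    ConcaveOn ℝ unitSquare fun z : ℝ × ℝ => psi ρ z.1 z.2 := by
  refine ⟨convex_unitSquare, fun z hz w hw a b ha hb hab => ?_⟩
  refine le_of_tendsto_of_tendsto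
    (((tendsto_psi_shrink ρ hz).const_smul a).add ((tendsto_psi_shrink ρ hw).const_smul b))
    (tendsto_psi_shrink ρ (convex_unitSquare hz hw ha hb hab)) ?_
  filter_upwards [Ioo_mem_nhdsGT (zero_lt_one' ℝ)] with ε hε
  have hz' := shrink_mem hε hz
  have hw' := shrink_mem hε hw
  have hv' := shrink_mem hε (convex_unitSquare hz hw ha hb hab)
  -- `shrink` is affine, so the plane at the shrunk convex combination bounds both endpoints and
  -- averages to its value there.
  obtain ⟨l, m, -, -, hlm⟩ := exists_supporting_plane h0 h1 hv'.1 hv'.2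
  have k1 := mul_le_mul_of_nonneg_left (hlm _ hz'.1 _ hz'.2) ha
  have k2 := mul_le_mul_of_nonneg_left (hlm _ hw'.1 _ hw'.2) hb
  have e1 : (shrink ε (a • z + b • w)).1 = a * (shrink ε z).1 + b * (shrink ε w).1 := by
    simp only [shrink, Prod.fst_add, Prod.smul_fst, smul_eq_mul]
    linear_combination (-(ε * (1 / 2))) * hab
  have e2 : (shrink ε (a • z + b • w)).2 = a * (shrink ε z).2 + b * (shrink ε w).2 := by
    simp only [shrink, Prod.snd_add, Prod.smul_snd, smul_eq_mul]
    linear_combination (-(ε * (1 / 2))) * hab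
  simp only [smul_eq_mul]
  generalize shrink ε (a • z + b • w) = v at *
  obtain rfl : b = 1 - a := by linarith
  rw [e1, e2] at k1 k2
  rw [e1, e2]
  linarith

lemma psi_mono {ρ : ℝ} (h0 : 0 < ρ) (h1 : ρ < 1) {z w : ℝ × ℝ} (hz : z ∈ unitSquare)
    (hw : w ∈ unitSquare) (hzw : z ≤ w) : psi ρ z.1 z.2 ≤ psi ρ w.1 w.2 := by
  refine le_of_tendsto_of_tendsto (tendsto_psi_shrink ρ hz) (tendsto_psi_shrink ρ hw) ?_
  filter_upwards [Ioo_mem_nhdsGT (zero_lt_one' ℝ)] with ε hε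
  have hz' := shrink_mem hε hz
  have hw' := shrink_mem hε hw
  obtain ⟨l, m, hl, hm, hlm⟩ := exists_supporting_plane h0 h1 hw'.1 hw'.2
  have h := hlm _ hz'.1 _ hz'.2
  have hε1 : 0 ≤ 1 - ε := by linarith [hε.2]
  have e1 : (shrink ε z).1 - (shrink ε w).1 ≤ 0 := by
    have := mul_le_mul_of_nonneg_left hzw.1 hε1
    simp only [shrink]
    linarith
  have e2 : (shrink ε z).2 - (shrink ε w).2 ≤ 0 := by
    have := mul_le_mul_of_nonneg_left hzw.2 hε1
    simp only [shrink]
    linarith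
  have := mul_nonpos_of_nonneg_of_nonpos hl e1
  have := mul_nonpos_of_nonneg_of_nonpos hm e2
  linarith

lemma isGreatest_psiValuesBelow {ρ : ℝ} (h0 : 0 < ρ) (h1 : ρ < 1) {α β : ℝ}
    (hα : α ∈ Icc (0 : ℝ) 1) (hβ : β ∈ Icc (0 : ℝ) 1) :
    IsGreatest (psiValuesBelow ρ α β) (psi ρ α β) := by
  refine ⟨⟨α, β, hα.1, le_rfl, hβ.1, le_rfl, rfl⟩, ?_⟩
  rintro _ ⟨s, t, hs0, hs, ht0, ht, rfl⟩
  exact psi_mono h0 h1 (z := (s, t)) (w := (α, β))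
    ⟨⟨hs0, hs.trans hα.2⟩, ht0, ht.trans hβ.2⟩ ⟨hα, hβ⟩ ⟨hs, ht⟩

/-- A function that agrees on `S` with a concave function is its own concave envelope. -/
lemma upperConcaveEnvelope_eq {S : Set (ℝ × ℝ)} {f g : ℝ × ℝ → ℝ} (hg : ConcaveOn ℝ S g)
    (hfg : ∀ z ∈ S, f z = g z) {x : ℝ × ℝ} (hx : x ∈ S) : upperConcaveEnvelope S f x = g x := by
  refine IsLeast.csInf_eq ⟨⟨g, hg, fun z hz => (hfg z hz).le, rfl⟩, ?_⟩
  rintro _ ⟨k, -, hk, rfl⟩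
  exact (hfg x hx).symm.le.trans (hk x hx)

end Envelope

end DSBS

theorem theorem2 (ρ : ℝ) (hρ0 : 0 < ρ) (hρ1 : ρ < 1) :
    ConcaveOn ℝ DSBS.unitSquare (fun z : ℝ × ℝ => DSBS.psi ρ z.1 z.2) ∧
    (∀ α ∈ Set.Icc (0 : ℝ) 1, ∀ β ∈ Set.Icc (0 : ℝ) 1,
      IsGreatest (DSBS.psiValuesBelow ρ α β) (DSBS.psiTilde ρ α β) ∧
      DSBS.psiTilde ρ α β = DSBS.psi ρ α β ∧
      DSBS.ThetaBar ρ α β = DSBS.psi ρ α β) := by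
  have hTilde : ∀ α ∈ Set.Icc (0 : ℝ) 1, ∀ β ∈ Set.Icc (0 : ℝ) 1,
      DSBS.psiTilde ρ α β = DSBS.psi ρ α β := fun α hα β hβ =>
    (DSBS.isGreatest_psiValuesBelow hρ0 hρ1 hα hβ).csSup_eq
  refine ⟨DSBS.concaveOn_psi hρ0 hρ1, fun α hα β hβ => ⟨?_, hTilde α hα β hβ, ?_⟩⟩
  · rw [hTilde α hα β hβ]
    exact DSBS.isGreatest_psiValuesBelow hρ0 hρ1 hα hβ
  · exact DSBS.upperConcaveEnvelope_eq (x := (α, β)) (DSBS.concaveOn_psi hρ0 hρ1)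
      (fun z hz => hTilde _ hz.1 _ hz.2) ⟨hα, hβ⟩
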